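/- **Conventions.** All lattices have a least element $0$ and a greatest element $1$ ($0=1$ is allowed), and lattice homomorphisms preserve $0$ and $1$. For a bitopological space $(S,\mathcal T^+,\mathcal T^-)$ let $\mathcal L^+$ be the family of all $U\in\mathcal T^+$ with $S\setminus U\in\mathcal T^-$, and $\mathcal L^-$ the family of all $U\in\mathcal T^-$ with $S\setminus U\in\mathcal T^+$. The space (possibly empty) is an *abstract spectrum* if $\mathcal L^{+}$ is a base of $\mathcal T^{+}$ and $\mathcal L^-$ is a base of $\mathcal T^-$, every $\mathcal T^+$-closed set is $\mathcal T^-$-compact and every $\mathcal T^-$-closed set is $\mathcal T^+$-compact, and at least one of $\mathcal T^+,\mathcal T^-$ is $T_0$. An $\mathbf S$-*morphism* is a map between abstract spectra that is continuous for the topologies $\mathcal T^+$ and for the topologies $\mathcal T^-$; an $\mathbf S$-*isomorphism* is a bijective $\mathbf S$-morphism whose inverse is an $\mathbf S$-morphism. Any family $S$ of subsets of a set $X$ carries the topology $\mathcal T^+$ with subbase $\{p\in S: x\notin p\}$, $x\in X$, and the topology $\mathcal T^-$ with subbase $\{p\in S: x\in p\}$, $x\in X$. For a distributive lattice $L$,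 $\operatorname{spec}(L)$ is the set of (proper) prime ideals of $L$ with these two topologies ($\mathcal T^+$ is the Stone topology). **Statement.** Let $X$ be a set with two arbitrary multivalued binary operations $\oplus,\otimes$ (maps $X\times X\to\{\text{subsets of }X\}$) and two fixed different points $\xi_0,\xi_1\in X$. A subset $p\subseteq X$ is a *prime ideal* of $(X,\oplus,\otimes)$ if $x,y\in p$ implies $x\oplus y\subseteq p$, and $(x\otimes y)\cap p\ne\emptyset$ implies $x\in p$ or $y\in p$; it is *proper* if moreover $\xi_0\in p$ and $\xi_1\notin p$. Let $S$ be either the family $S(X)_{pr}$ of all proper prime ideals or the family $S(X)$ of all prime ideals. Then there exist a distributive lattice $L$ and a function $\varphi:X\to L$ such that: (i) $\varphi(X)$ generates $L$ (as a lattice with $0$ and $1$); (ii) $\varphi^{-1}(q)\in S$ for every $q\in\operatorname{spec}(L)$; (iii) $\Phi:\operatorname{spec}(L)\to S$, $q\mapsto\varphi^{-1}(q)$, is an $\mathbf S$-isomorphism; (iv) if $L'$ is a distributive lattice and $\theta:X\to L'$ is a function such that $\theta^{-1}(q)\in S$ for every $q\in\operatorname{spec}(L')$ and $\operatorname{spec}(L')\to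 S$, $q\mapsto\theta^{-1}(q)$, is an $\mathbf S$-morphism, then there is a unique lattice homomorphism $l:L\to L'$ with $l\circ\varphi=\theta$; (v) if $L_1$ is a distributive lattice and $\varphi_1:X\to L_1$ is a function such that $\varphi_1^{-1}(q)\in S$ for every $q\in\operatorname{spec}(L_1)$ and $\operatorname{spec}(L_1)\to S$, $q\mapsto\varphi_1^{-1}(q)$, is an $\mathbf S$-isomorphism, then there is a unique lattice isomorphism $l:L\to L_1$ with $l\circ\varphi=\varphi_1$; (vi) $a\oplus b\subseteq\{x\in X:\varphi(x)\le\varphi(a)\vee\varphi(b)\}$ and $a\otimes b\subseteq\{x\in X:\varphi(x)\ge\varphi(a)\wedge\varphi(b)\}$ for all $a,b\in X$. -/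

import Mathlib

universe u v

/-- A bitopological space: a set with two topologies `𝒯⁺` and `𝒯⁻`. -/
structure BitopologicalSpace (S : Type*) where
  /-- the topology `𝒯⁺` -/
  plus : TopologicalSpace S
  /-- the topology `𝒯⁻` -/
  minus : TopologicalSpace S

namespace BitopologicalSpace

/-- `ℒ⁺`: the `𝒯⁺`-open sets whose complement is `𝒯⁻`-open. -/
def latticePlus {S : Type*} (B : BitopologicalSpace S) : Set (Set S) :=
  {U | @IsOpen S B.plus U ∧ @IsOpen S B.minus Uᶜ}

/-- `ℒ⁻`: the `𝒯⁻`-open sets whose complement is `𝒯⁺`-open. -/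
def latticeMinus {S : Type*} (B : BitopologicalSpace S) : Set (Set S) :=
  {U | @IsOpen S B.minus U ∧ @IsOpen S B.plus Uᶜ}

/-- Abstract spectra. The empty bitopological space is admitted: it is the spectrum of the
one-element lattice, and it is the space of proper prime ideals when there are none. -/
structure IsAbstractSpectrum {S : Type*} (B : BitopologicalSpace S) : Prop where
  /-- (SP1) for `𝒯⁺` -/
  basis_plus : @TopologicalSpace.IsTopologicalBasis S B.plus B.latticePlus
  /-- (SP1) for `𝒯⁻` -/
  basis_minus : @TopologicalSpace.IsTopologicalBasis S B.minus B.latticeMinus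
  /-- (SP2): `𝒯⁺`-closed sets are `𝒯⁻`-compact -/
  compact_minus : ∀ F : Set S, @IsOpen S B.plus Fᶜ → @IsCompact S B.minus F
  /-- (SP2): `𝒯⁻`-closed sets are `𝒯⁺`-compact -/
  compact_plus : ∀ F : Set S, @IsOpen S B.minus Fᶜ → @IsCompact S B.plus F
  /-- (SP3) -/
  t0 : @T0Space S B.plus ∨ @T0Space S B.minus

/-- A morphism of abstract spectra: a map between abstract spectra which is continuous for the
topologies `𝒯⁺` and for the topologies `𝒯⁻`. -/
structure IsSMorphism {S T : Type*} (B : BitopologicalSpace S) (C : BitopologicalSpace T)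
    (f : S → T) : Prop where
  source : B.IsAbstractSpectrum
  target : C.IsAbstractSpectrum
  continuous_plus : @Continuous S T B.plus C.plus f
  continuous_minus : @Continuous S T B.minus C.minus f

/-- An isomorphism in the category of abstract spectra. -/
def IsSIsomorphism {S T : Type*} (B : BitopologicalSpace S) (C : BitopologicalSpace T)
    (f : S → T) : Prop :=
  IsSMorphism B C f ∧
    ∃ g : T → S, IsSMorphism C B g ∧ Function.LeftInverse g f ∧ Function.RightInverse g f

end BitopologicalSpace

/-- The two topologies on a family `S` of subsets of `X`: the sets `{p ∈ S | x ∉ p}`, `x ∈ X`, are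
a subbase of `𝒯⁺`, and the sets `{p ∈ S | x ∈ p}`, `x ∈ X`, are a subbase of `𝒯⁻`. -/
def familyBitopology {X : Type*} (S : Set (Set X)) : BitopologicalSpace S where
  plus := TopologicalSpace.generateFrom (Set.range fun x : X => {p : S | x ∉ (p : Set X)})
  minus := TopologicalSpace.generateFrom (Set.range fun x : X => {p : S | x ∈ (p : Set X)})

/-- `p` is a prime ideal in `(X, ⊕, ⊗)`, for multivalued operations `⊕` and `⊗`. -/
structure IsMultiPrimeIdeal {X : Type*} (oplus otimes : X → X → Set X) (p : Set X) : Prop where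
  oplus_subset : ∀ x y, x ∈ p → y ∈ p → oplus x y ⊆ p
  mem_or_mem : ∀ x y, (otimes x y ∩ p).Nonempty → x ∈ p ∨ y ∈ p

/-- `S(X)`: the set of all prime ideals in `(X, ⊕, ⊗)`. -/
def primeIdeals {X : Type*} (oplus otimes : X → X → Set X) : Set (Set X) :=
  {p | IsMultiPrimeIdeal oplus otimes p}

/-- `S(X)_pr`: the set of all prime ideals in `(X, ⊕, ⊗)` that are proper with respect to the
points `ξ₀` and `ξ₁`. -/
def properPrimeIdeals {X : Type*} (oplus otimes : X → X → Set X) (ξ₀ ξ₁ : X) : Set (Set X) :=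
  {p | IsMultiPrimeIdeal oplus otimes p ∧ ξ₀ ∈ p ∧ ξ₁ ∉ p}

/-- `spec(L)`: the set of all (proper) prime ideals of the lattice `L`. It carries the topologies
of `familyBitopology`, of which `𝒯⁺` is the Stone topology. -/
def latticeSpec (L : Type*) [DistribLattice L] : Set (Set L) :=
  {q | ∃ I : Order.Ideal L, I.IsPrime ∧ (I : Set L) = q}

/-- For `φ : X → L` such that `φ⁻¹(q) ∈ S` for every `q ∈ spec(L)`, the map `spec(L) → S`,
`q ↦ φ⁻¹(q)`. -/
def specPreimage {X L : Type*} [DistribLattice L] (S : Set (Set X)) (φ : X → L)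
    (h : ∀ q ∈ latticeSpec L, φ ⁻¹' q ∈ S) : latticeSpec L → S :=
  fun q => ⟨φ ⁻¹' (q : Set L), h q q.2⟩

/-- The subset `A` generates `L` as a lattice with `0` and `1`. -/
def GeneratesLattice {L : Type*} [DistribLattice L] [BoundedOrder L] (A : Set L) : Prop :=
  ∀ M : Sublattice L, ⊥ ∈ M → ⊤ ∈ M → A ⊆ M → ∀ a : L, a ∈ M

/-! Each condition defining a prime ideal involves finitely many points of `X`, so `S` is a closed
subset of the Cantor cube `X → Bool`. Both topologies on `S` are coarser than the compact topology
of the cube, which makes `S` an abstract spectrum. Take for `L` the lattice of subsets of `S`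
generated by the sets `{p | x ∉ p}`, with `φ` sending `x` to this set. A prime ideal of `L` is
determined by its trace on the generators, and a point `p` gives back the prime ideal `{U | p ∉ U}`;
hence spec(`L`) is `S` (`isSIsomorphism_specPreimage`). The universal property holds because
elements of a distributive lattice are separated by prime ideals (`latticeSpec.le_iff`): the image
of `U` must be the element lying in exactly those `q` with `θ⁻¹(q) ∉ U`. For an isomorphism of
spectra this map is also onto, since compactness puts all of `ℒ⁺` into `L`
(`mem_of_mem_latticePlus`). -/

open Set TopologicalSpace
open scoped Topology

/-! ### Families closed under pointwise convergence are abstract spectra. -/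

section Family

variable {X : Type*} (S : Set (Set X))

lemma familyBitopology_isOpen_plus (x : X) :
    IsOpen[(familyBitopology S).plus] {p : S | x ∉ (p : Set X)} :=
  isOpen_generateFrom_of_mem ⟨x, rfl⟩

lemma familyBitopology_isOpen_minus (x : X) :
    IsOpen[(familyBitopology S).minus] {p : S | x ∈ (p : Set X)} :=
  isOpen_generateFrom_of_mem ⟨x, rfl⟩

/-- If `t` is generated by sets whose complements are open for `t'`, then the `t`-open sets with
`t'`-open complement form a base of `t`. -/
lemma isTopologicalBasis_of_generateFrom_of_isOpen_compl {T : Type*} (t t' : TopologicalSpace T)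
    (s : Set (Set T)) (ht : t = generateFrom s) (hs : ∀ U ∈ s, IsOpen[t'] Uᶜ) :
    @IsTopologicalBasis T t {U | IsOpen[t] U ∧ IsOpen[t'] Uᶜ} := by
  have hb := @isTopologicalBasis_of_subbasis T t s ht
  refine @IsTopologicalBasis.of_isOpen_of_subset T t _ _ (fun U hU => hU.1) hb ?_
  intro U hU
  refine ⟨@IsTopologicalBasis.isOpen T t _ _ hb hU, ?_⟩
  obtain ⟨f, ⟨-, hfs⟩, rfl⟩ := hU
  rw [compl_sInter]
  refine @isOpen_sUnion T t' _ ?_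
  rintro _ ⟨V, hV, rfl⟩
  exact hs V (hfs hV)

/-- A family of subsets of `X` that is closed in the space of all subsets of `X` (with the topology
of pointwise convergence) is an abstract spectrum. -/
theorem isAbstractSpectrum_familyBitopology
    (hS : IsClosed {f : X → Bool | {x | f x = true} ∈ S}) :
    (familyBitopology S).IsAbstractSpectrum := by
  let K := {f : X → Bool | {x | f x = true} ∈ S}
  have : CompactSpace K := isCompact_iff_compactSpace.mp hS.isCompact
  let r : K → S := fun f => ⟨{x | f.1 x = true}, f.2⟩
  have hr : Function.Surjective r := by
    classical
    rintro ⟨p, hp⟩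
    have h : {x | decide (x ∈ p) = true} = p := by simp
    exact ⟨⟨fun x => decide (x ∈ p), show {x | decide (x ∈ p) = true} ∈ S by rwa [h]⟩,
      Subtype.ext h⟩
  have heval (x : X) (b : Bool) : IsOpen {f : K | f.1 x = b} :=
    (isOpen_discrete {b}).preimage (f := fun f : K => f.1 x)
      ((continuous_apply x).comp continuous_subtype_val)
  have hplus : @Continuous K S _ (familyBitopology S).plus r := by
    refine continuous_generateFrom_iff.mpr ?_
    rintro _ ⟨x, rfl⟩
    simpa [r] using heval x false
  have hminus : @Continuous K S _ (familyBitopology S).minus r := by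
    refine continuous_generateFrom_iff.mpr ?_
    rintro _ ⟨x, rfl⟩
    exact heval x true
  have hcompact (t t' : TopologicalSpace S) (ht : @Continuous K S _ t r)
      (ht' : @Continuous K S _ t' r) (F : Set S) (hF : IsOpen[t] Fᶜ) : @IsCompact S t' F := by
    -- Pulled back to the compact space `K`, the set `F` is closed, hence compact; its image under
    -- the surjection `r` is `F` again.
    have hK : IsClosed (r ⁻¹' F) := ⟨@IsOpen.preimage K S _ t r ht _ hF⟩
    rw [← image_preimage_eq F hr]
    exact @IsCompact.image K S _ t' _ r hK.isCompact ht'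
  refine ⟨?_, ?_, hcompact _ _ hplus hminus, hcompact _ _ hminus hplus, .inl ?_⟩
  · refine isTopologicalBasis_of_generateFrom_of_isOpen_compl _ _ _ rfl ?_
    rintro _ ⟨x, rfl⟩
    convert familyBitopology_isOpen_minus S x using 1
    ext; simp
  · refine isTopologicalBasis_of_generateFrom_of_isOpen_compl _ _ _ rfl ?_
    rintro _ ⟨x, rfl⟩
    exact familyBitopology_isOpen_plus S x
  · refine @T0Space.mk S (familyBitopology S).plus fun p q hpq => ?_
    ext x
    have := (@inseparable_iff_forall_isOpen S (familyBitopology S).plus p q).mp hpq _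
      (familyBitopology_isOpen_plus S x)
    exact not_iff_not.mp this

/-- Nonemptiness of `otimes x y ∩ p` occurs only as a premise, so it becomes a universal quantifier
over `z`, and every condition is an intersection of clopen ones. -/
lemma isClosed_primeIdeals (oplus otimes : X → X → Set X) :
    IsClosed {f : X → Bool | {x | f x = true} ∈ primeIdeals oplus otimes} := by
  have h : {f : X → Bool | {x | f x = true} ∈ primeIdeals oplus otimes} =
      (⋂ (x) (y), ⋂ z ∈ oplus x y, {f | f x = true → f y = true → f z = true}) ∩
      (⋂ (x) (y), ⋂ z ∈ otimes x y, {f | f z = true → f x = true ∨ f y = true}) := by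
    ext f
    simp only [mem_inter_iff, mem_iInter, mem_ofPred_eq, primeIdeals]
    constructor
    · rintro ⟨h₁, h₂⟩
      exact ⟨fun x y z hz hx hy => h₁ x y hx hy hz, fun x y z hz hf => h₂ x y ⟨z, hz, hf⟩⟩
    · rintro ⟨h₁, h₂⟩
      exact ⟨fun x y hx hy z hz => h₁ x y z hz hx hy, fun x y ⟨z, hz, hf⟩ => h₂ x y z hz hf⟩
  have hcl (x : X) : IsClopen {f : X → Bool | f x = true} :=
    (isClopen_discrete {true}).preimage (continuous_apply x)
  rw [h]
  refine .inter ?_ ?_ <;> refine isClosed_iInter fun x => isClosed_iInter fun y =>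
    isClosed_biInter fun z _ => ?_
  · exact isClosed_imp (hcl x).isOpen (isClosed_imp (hcl y).isOpen (hcl z).isClosed)
  · exact isClosed_imp (hcl z).isOpen ((hcl x).isClosed.union (hcl y).isClosed)

lemma isClosed_properPrimeIdeals (oplus otimes : X → X → Set X) (ξ₀ ξ₁ : X) :
    IsClosed {f : X → Bool | {x | f x = true} ∈ properPrimeIdeals oplus otimes ξ₀ ξ₁} := by
  have hcl (x : X) : IsClopen {f : X → Bool | f x = true} :=
    (isClopen_discrete {true}).preimage (continuous_apply x)
  exact (isClosed_primeIdeals oplus otimes).inter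
    ((hcl ξ₀).isClosed.inter (hcl ξ₁).compl.isClosed)

end Family

/-! ### Prime ideals of distributive lattices. -/

section Lattice

variable {L : Type*} [DistribLattice L]

/-- The proper prime ideals of a bounded distributive lattice are the proper prime ideals for the
multivalued operations `(a, b) ↦ Iic (a ⊔ b)` and `(a, b) ↦ Ici (a ⊓ b)`. -/
lemma latticeSpec_eq_properPrimeIdeals [BoundedOrder L] :
    latticeSpec L =
      properPrimeIdeals (fun a b : L => Iic (a ⊔ b)) (fun a b => Ici (a ⊓ b)) ⊥ ⊤ := by
  ext q
  constructor
  · rintro ⟨I, hI, rfl⟩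
    refine ⟨⟨fun x y hx hy z hz => I.lower hz (I.sup_mem hx hy), ?_⟩, I.bot_mem, ?_⟩
    · rintro x y ⟨z, hz, hzI⟩
      exact hI.mem_or_mem (I.lower hz hzI)
    · exact hI.toIsProper.top_notMem
  · rintro ⟨⟨h₁, h₂⟩, h₀, h₃⟩
    let I : Order.Ideal L :=
      { carrier := q
        -- Downward closure is the condition on `⊕` with both arguments equal to `a`.
        lower' := fun a b hba ha => h₁ a a ha ha (by simpa using hba)
        nonempty' := ⟨⊥, h₀⟩
        directed' := fun a ha b hb => ⟨a ⊔ b, h₁ a b ha hb self_mem_Iic, le_sup_left, le_sup_right⟩ }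
    have : I.IsProper := Order.Ideal.isProper_of_notMem (p := ⊤) h₃
    exact ⟨I, .of_mem_or_mem fun {x y} hxy => h₂ x y ⟨x ⊓ y, self_mem_Ici, hxy⟩, rfl⟩

theorem isAbstractSpectrum_latticeSpec [BoundedOrder L] :
    (familyBitopology (latticeSpec L)).IsAbstractSpectrum := by
  rw [latticeSpec_eq_properPrimeIdeals]
  exact isAbstractSpectrum_familyBitopology _ (isClosed_properPrimeIdeals _ _ _ _)

namespace latticeSpec

variable (q : latticeSpec L) (a b : L)

lemma sup_mem_iff : a ⊔ b ∈ q.1 ↔ a ∈ q.1 ∧ b ∈ q.1 := by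
  obtain ⟨_, I, hI, rfl⟩ := q
  exact Order.Ideal.sup_mem_iff

lemma inf_mem_iff : a ⊓ b ∈ q.1 ↔ a ∈ q.1 ∨ b ∈ q.1 := by
  obtain ⟨_, I, hI, rfl⟩ := q
  exact ⟨hI.mem_or_mem, fun h => h.elim (I.lower inf_le_left) (I.lower inf_le_right)⟩

lemma bot_mem [OrderBot L] : ⊥ ∈ q.1 := by
  obtain ⟨_, I, hI, rfl⟩ := q
  exact I.bot_mem

lemma top_notMem [OrderTop L] : ⊤ ∉ q.1 := by
  obtain ⟨_, I, hI, rfl⟩ := q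
  exact hI.toIsProper.top_notMem

variable {a b}

/-- If `a ≰ b`, the filter above `a` and the ideal below `b` are disjoint, and the prime ideal
theorem separates them. -/
lemma le_iff : a ≤ b ↔ ∀ q : latticeSpec L, b ∈ q.1 → a ∈ q.1 := by
  constructor
  · rintro h ⟨_, I, hI, rfl⟩ hb
    exact I.lower h hb
  · intro h
    by_contra hab
    have hd : Disjoint (Order.PFilter.principal a : Set L) (Order.Ideal.principal b : Set L) := by
      rw [Set.disjoint_left]
      intro c hac hcb
      exact hab (le_trans (Order.PFilter.mem_principal.mp hac) (Order.Ideal.mem_principal.mp hcb))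
    obtain ⟨J, hJ, hbJ, hdJ⟩ := DistribLattice.prime_ideal_of_disjoint_filter_ideal hd
    exact Set.disjoint_left.mp hdJ (Order.PFilter.mem_principal.mpr le_rfl)
      (h ⟨J, J, hJ, rfl⟩ (hbJ (Order.Ideal.mem_principal.mpr le_rfl)))

lemma eq_iff : a = b ↔ ∀ q : latticeSpec L, a ∈ q.1 ↔ b ∈ q.1 := by
  rw [le_antisymm_iff, le_iff, le_iff, ← forall_and]
  exact forall_congr' fun q => ⟨fun h => ⟨h.2, h.1⟩, fun h => ⟨h.2, h.1⟩⟩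

end latticeSpec

/-- The equalizer is a sublattice containing `⊥` and `⊤`. Stated for a hom class so as to give
uniqueness both of homomorphisms and of isomorphisms. -/
lemma GeneratesLattice.eqOn {L' F : Type*} [BoundedOrder L] [DistribLattice L'] [BoundedOrder L']
    [FunLike F L L'] [BoundedLatticeHomClass F L L'] {A : Set L} (hA : GeneratesLattice A)
    {f g : F} (h : EqOn f g A) : f = g := by
  let M : Sublattice L :=
    { carrier := {a | f a = g a}
      supClosed' := fun a (ha : f a = g a) b (hb : f b = g b) => by
        simp only [mem_ofPred_eq, map_sup, ha, hb]
      infClosed' := fun a (ha : f a = g a) b (hb : f b = g b) => by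
        simp only [mem_ofPred_eq, map_inf, ha, hb] }
  exact DFunLike.ext f g (hA M ((map_bot f).trans (map_bot g).symm)
    ((map_top f).trans (map_top g).symm) h)

end Lattice

/-! ### The lattice dual to a family of subsets. -/

section Construction

variable {X : Type*} (S : Set (Set X))

/-- The lattice of subsets of `S` generated by the sets `{p ∈ S | x ∉ p}`, `x ∈ X`. -/
def familyLattice : Sublattice (Set S) :=
  sInf {M | ⊥ ∈ M ∧ ⊤ ∈ M ∧ ∀ x : X, {p : S | x ∉ (p : Set X)} ∈ M}

namespace familyLattice

instance : BoundedOrder (familyLattice S) :=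
  Subtype.boundedOrder (Sublattice.mem_sInf.mpr fun _ hM => hM.1)
    (Sublattice.mem_sInf.mpr fun _ hM => hM.2.1)

/-- The canonical map `x ↦ {p ∈ S | x ∉ p}`. -/
def of (x : X) : familyLattice S :=
  ⟨{p | x ∉ (p : Set X)}, Sublattice.mem_sInf.mpr fun _ hM => hM.2.2 x⟩

variable {S}

lemma coe_bot : ((⊥ : familyLattice S) : Set S) = ∅ := rfl

lemma coe_top : ((⊤ : familyLattice S) : Set S) = univ := rfl

variable (S)

lemma generatesLattice : GeneratesLattice (range (of S)) := by
  rintro M hbot htop hM ⟨U, hU⟩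
  have : U ∈ M.map (familyLattice S).subtype :=
    Sublattice.mem_sInf.mp hU _ ⟨⟨_, hbot, rfl⟩, ⟨_, htop, rfl⟩, fun x => ⟨_, hM ⟨x, rfl⟩, rfl⟩⟩
  obtain ⟨V, hV, hVU⟩ := this
  have hVU : V = ⟨U, hU⟩ := Subtype.ext hVU
  exact hVU ▸ hV

variable {S}

/-- Induction over the lattice generated by the canonical map. -/
lemma induction {P : familyLattice S → Prop} (bot : P ⊥) (top : P ⊤) (of : ∀ x, P (of S x))
    (sup : ∀ U V, P U → P V → P (U ⊔ V)) (inf : ∀ U V, P U → P V → P (U ⊓ V))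
    (U : familyLattice S) : P U :=
  generatesLattice S
    { carrier := {U | P U}
      supClosed' := fun U hU V hV => sup U V hU hV
      infClosed' := fun U hU V hV => inf U V hU hV } bot top (by rintro _ ⟨x, rfl⟩; exact of x) U

lemma isOpen_plus (U : familyLattice S) : IsOpen[(familyBitopology S).plus] U.1 := by
  let := (familyBitopology S).plus
  induction U using induction with
  | bot => exact isOpen_empty
  | top => exact isOpen_univ
  | of x => exact familyBitopology_isOpen_plus S x
  | sup U V hU hV => exact IsOpen.union hU hV
  | inf U V hU hV => exact IsOpen.inter hU hV

lemma isOpen_compl_minus (U : familyLattice S) :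
    IsOpen[(familyBitopology S).minus] (U.1)ᶜ := by
  let := (familyBitopology S).minus
  induction U using induction with
  | bot => rw [coe_bot, compl_empty]; exact isOpen_univ
  | top => rw [coe_top, compl_univ]; exact isOpen_empty
  | of x =>
    convert familyBitopology_isOpen_minus S x using 1
    ext p
    exact not_not
  | sup U V hU hV =>
    rw [Sublattice.coe_sup, compl_sup]
    exact IsOpen.inter hU hV
  | inf U V hU hV =>
    rw [Sublattice.coe_inf, compl_inf]
    exact IsOpen.union hU hV

/-- In an abstract spectrum, the lattice generated by the canonical map is all of `ℒ⁺`. -/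
lemma mem_of_mem_latticePlus (hS : (familyBitopology S).IsAbstractSpectrum) {U : Set S}
    (hU : U ∈ (familyBitopology S).latticePlus) : U ∈ familyLattice S := by
  let := (familyBitopology S).plus
  have hb := isTopologicalBasis_of_subbasis (t := (familyBitopology S).plus) rfl
  -- `U` is `𝒯⁻`-closed, hence `𝒯⁺`-compact, hence a finite union of finite intersections of
  -- subbasic sets.
  obtain ⟨s, rfl⟩ := eq_sUnion_finset_of_isTopologicalBasis_of_isCompact_open _ hb U
    (hS.compact_plus U hU.2) hU.1
  have hbasic (V : Set S) (hV : V ∈ (fun f => ⋂₀ f) ''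
      {f : Set (Set S) | f.Finite ∧ f ⊆ range fun x : X => {p : S | x ∉ (p : Set X)}}) :
      V ∈ familyLattice S := by
    obtain ⟨f, ⟨hf, hfs⟩, rfl⟩ := hV
    induction f, hf using Set.Finite.induction_on with
    | empty => simp only [sInter_empty]; exact (⊤ : familyLattice S).2
    | @insert W f _ _ ih =>
      obtain ⟨⟨x, rfl⟩, hfs'⟩ := insert_subset_iff.mp hfs
      simp only [sInter_insert]
      exact (familyLattice S).infClosed (of S x).2 (ih hfs')
  clear hU
  induction s using Finset.cons_induction with
  | empty => rw [Finset.coe_empty, image_empty, sUnion_empty]; exact (⊥ : familyLattice S).2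
  | cons V s _ ih =>
    simpa using (familyLattice S).supClosed (hbasic V.1 V.2) ih

/-- The point `p` of `S` defines the prime ideal of all `U` with `p ∉ U`. -/
def idealOf (p : S) : latticeSpec (familyLattice S) :=
  ⟨{U | p ∉ U.1}, by
    rw [latticeSpec_eq_properPrimeIdeals]
    refine ⟨⟨fun U V hU hV W hW hp => ?_, ?_⟩, fun h => h, fun h => h trivial⟩
    · exact (hW hp).elim hU hV
    · rintro U V ⟨W, hW, hp⟩
      by_contra! h
      exact hp (hW ⟨not_not.mp h.1, not_not.mp h.2⟩)⟩

lemma mem_idealOf {p : S} {U : familyLattice S} : U ∈ (idealOf p).1 ↔ p ∉ U.1 := Iff.rfl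

section

variable (h : ∀ q ∈ latticeSpec (familyLattice S), of S ⁻¹' q ∈ S)

/-- Both sides turn joins into conjunctions and, by primality, meets into disjunctions, so only the
generators matter. This makes `idealOf` a left inverse of `specPreimage`. -/
lemma mem_specPreimage_iff (q : latticeSpec (familyLattice S)) (U : familyLattice S) :
    U ∈ q.1 ↔ specPreimage S (of S) h q ∉ U.1 := by
  induction U using induction with
  | bot => exact iff_of_true (latticeSpec.bot_mem q) (fun h => h)
  | top => exact iff_of_false (latticeSpec.top_notMem q) (fun h => h trivial)
  | of x => exact not_not.symm
  | sup U V hU hV =>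
    rw [latticeSpec.sup_mem_iff, hU, hV, ← not_or]; rfl
  | inf U V hU hV =>
    rw [latticeSpec.inf_mem_iff, hU, hV, ← not_and_or]; rfl

theorem isSIsomorphism_specPreimage (hS : (familyBitopology S).IsAbstractSpectrum) :
    BitopologicalSpace.IsSIsomorphism (familyBitopology (latticeSpec (familyLattice S)))
      (familyBitopology S) (specPreimage S (of S) h) := by
  refine ⟨⟨isAbstractSpectrum_latticeSpec, hS, ?_, ?_⟩, idealOf,
    ⟨hS, isAbstractSpectrum_latticeSpec, ?_, ?_⟩, fun q => ?_, fun p => ?_⟩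
  · refine continuous_generateFrom_iff.mpr ?_
    rintro _ ⟨x, rfl⟩
    exact familyBitopology_isOpen_plus _ (of S x)
  · refine continuous_generateFrom_iff.mpr ?_
    rintro _ ⟨x, rfl⟩
    exact familyBitopology_isOpen_minus _ (of S x)
  -- The preimage of `{q | U ∉ q}` under `idealOf` is `U` itself; that of `{q | U ∈ q}` is its
  -- complement.
  · refine continuous_generateFrom_iff.mpr ?_
    rintro _ ⟨U, rfl⟩
    convert isOpen_plus U using 1
    ext p
    simp [mem_idealOf]
  · refine continuous_generateFrom_iff.mpr ?_
    rintro _ ⟨U, rfl⟩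
    exact isOpen_compl_minus U
  · ext U
    rw [mem_idealOf, mem_specPreimage_iff h]
  · ext x
    exact not_not

end

section Lift

variable {L : Type*} [DistribLattice L] [BoundedOrder L] {θ : X → L}
  (h : ∀ q ∈ latticeSpec L, θ ⁻¹' q ∈ S)

/-- Such an `a` is unique by `latticeSpec.eq_iff`, so choosing it for each `U` automatically
respects the lattice operations. -/
lemma exists_forall_mem_iff (U : familyLattice S) :
    ∃ a : L, ∀ q : latticeSpec L, a ∈ q.1 ↔ specPreimage S θ h q ∉ U.1 := by
  induction U using induction with
  | bot => exact ⟨⊥, fun q => iff_of_true (latticeSpec.bot_mem q) (fun h => h)⟩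
  | top => exact ⟨⊤, fun q => iff_of_false (latticeSpec.top_notMem q) (fun h => h trivial)⟩
  | of x => exact ⟨θ x, fun q => not_not.symm⟩
  | sup U V hU hV =>
    obtain ⟨a, ha⟩ := hU
    obtain ⟨b, hb⟩ := hV
    exact ⟨a ⊔ b, fun q => by rw [latticeSpec.sup_mem_iff, ha, hb, ← not_or]; rfl⟩
  | inf U V hU hV =>
    obtain ⟨a, ha⟩ := hU
    obtain ⟨b, hb⟩ := hV
    exact ⟨a ⊓ b, fun q => by rw [latticeSpec.inf_mem_iff, ha, hb, ← not_and_or]; rfl⟩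

/-- The function underlying `familyLattice.lift`. -/
noncomputable def liftFun (U : familyLattice S) : L := (exists_forall_mem_iff h U).choose

lemma liftFun_mem_iff (U : familyLattice S) (q : latticeSpec L) :
    liftFun h U ∈ q.1 ↔ specPreimage S θ h q ∉ U.1 :=
  (exists_forall_mem_iff h U).choose_spec q

/-- The lattice homomorphism dual to the map `q ↦ θ⁻¹(q)`. -/
noncomputable def lift : BoundedLatticeHom (familyLattice S) L where
  toFun := liftFun h
  map_sup' U V := latticeSpec.eq_iff.mpr fun q => by
    rw [latticeSpec.sup_mem_iff, liftFun_mem_iff, liftFun_mem_iff, liftFun_mem_iff, ← not_or]; rfl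
  map_inf' U V := latticeSpec.eq_iff.mpr fun q => by
    rw [latticeSpec.inf_mem_iff, liftFun_mem_iff, liftFun_mem_iff, liftFun_mem_iff,
      ← not_and_or]
    rfl
  map_top' := latticeSpec.eq_iff.mpr fun q =>
    iff_of_false (fun hq => (liftFun_mem_iff h _ q).mp hq trivial) (latticeSpec.top_notMem q)
  map_bot' := latticeSpec.eq_iff.mpr fun q =>
    iff_of_true ((liftFun_mem_iff h _ q).mpr fun hq => hq) (latticeSpec.bot_mem q)

lemma lift_mem_iff (U : familyLattice S) (q : latticeSpec L) :
    lift h U ∈ q.1 ↔ specPreimage S θ h q ∉ U.1 :=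
  liftFun_mem_iff h U q

lemma lift_comp_of : lift h ∘ of S = θ :=
  funext fun _ => latticeSpec.eq_iff.mpr fun q => (lift_mem_iff h _ q).trans not_not

/-- Surjectivity turns a test over all prime ideals of `L` into a test over all points of `S`. -/
lemma lift_le_lift_iff (hsurj : Function.Surjective (specPreimage S θ h))
    {U V : familyLattice S} : lift h U ≤ lift h V ↔ U ≤ V := by
  rw [latticeSpec.le_iff]
  simp only [lift_mem_iff, not_imp_not]
  exact ⟨fun hUV p => (hsurj p).elim fun q hq => by
    subst hq; exact hUV q, fun hUV q => @hUV _⟩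

/-- The inverse `g` carries the set of `q` omitting `a` to a member of `ℒ⁺` on `S`, which therefore
lies in `familyLattice S`; its lift lies in the same prime ideals as `a`. -/
lemma lift_surjective
    (hiso : BitopologicalSpace.IsSIsomorphism (familyBitopology (latticeSpec L))
      (familyBitopology S) (specPreimage S θ h)) : Function.Surjective (lift h) := by
  obtain ⟨hf, g, hg, hgf, hfg⟩ := hiso
  intro a
  have hU : g ⁻¹' {q | a ∉ q.1} ∈ (familyBitopology S).latticePlus := by
    constructor
    · exact @Continuous.isOpen_preimage _ _ (_) (_) _ hg.continuous_plus _
        (familyBitopology_isOpen_plus _ a)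
    · have hV := @Continuous.isOpen_preimage _ _ (_) (_) _ hg.continuous_minus _
        (familyBitopology_isOpen_minus _ a)
      rwa [← compl_compl (g ⁻¹' {q | a ∈ q.1})] at hV
  refine ⟨⟨_, mem_of_mem_latticePlus hf.target hU⟩, latticeSpec.eq_iff.mpr fun q => ?_⟩
  rw [lift_mem_iff, mem_preimage, hgf q]
  exact not_not

end Lift

end familyLattice

end Construction

theorem corollary2p4p2 {X : Type u} (oplus otimes : X → X → Set X) (ξ₀ ξ₁ : X)
    (hξ : ξ₀ ≠ ξ₁) (S : Set (Set X))
    (hS : S = properPrimeIdeals oplus otimes ξ₀ ξ₁ ∨ S = primeIdeals oplus otimes) :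
    ∃ (L : Type u) (_ : DistribLattice L) (_ : BoundedOrder L) (φ : X → L),
      GeneratesLattice (Set.range φ) ∧
      (∃ h : ∀ q ∈ latticeSpec L, φ ⁻¹' q ∈ S,
        BitopologicalSpace.IsSIsomorphism (familyBitopology (latticeSpec L)) (familyBitopology S)
          (specPreimage S φ h)) ∧
      (∀ (L' : Type v) [DistribLattice L'] [BoundedOrder L'] (θ : X → L')
        (hθ : ∀ q ∈ latticeSpec L', θ ⁻¹' q ∈ S),
        BitopologicalSpace.IsSMorphism (familyBitopology (latticeSpec L')) (familyBitopology S)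
          (specPreimage S θ hθ) →
        ∃! l : BoundedLatticeHom L L', ⇑l ∘ φ = θ) ∧
      (∀ (L₁ : Type v) [DistribLattice L₁] [BoundedOrder L₁] (φ₁ : X → L₁)
        (hφ₁ : ∀ q ∈ latticeSpec L₁, φ₁ ⁻¹' q ∈ S),
        BitopologicalSpace.IsSIsomorphism (familyBitopology (latticeSpec L₁)) (familyBitopology S)
          (specPreimage S φ₁ hφ₁) →
        ∃! l : L ≃o L₁, ⇑l ∘ φ = φ₁) ∧
      (∀ a b : X, oplus a b ⊆ {x | φ x ≤ φ a ⊔ φ b}) ∧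
      (∀ a b : X, otimes a b ⊆ {x | φ a ⊓ φ b ≤ φ x}) := by
  have hspec : (familyBitopology S).IsAbstractSpectrum := by
    obtain rfl | rfl := hS
    · exact isAbstractSpectrum_familyBitopology _ (isClosed_properPrimeIdeals _ _ _ _)
    · exact isAbstractSpectrum_familyBitopology _ (isClosed_primeIdeals _ _)
  have hprime : ∀ p ∈ S, IsMultiPrimeIdeal oplus otimes p := by
    obtain rfl | rfl := hS
    exacts [fun p hp => hp.1, fun p hp => hp]
  have hoplus : ∀ a b : X, oplus a b ⊆
      {x | familyLattice.of S x ≤ familyLattice.of S a ⊔ familyLattice.of S b} := by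
    intro a b x hx p hpx
    by_contra hp
    have hab := not_or.mp hp
    exact hpx ((hprime p p.2).oplus_subset a b (not_not.mp hab.1) (not_not.mp hab.2) hx)
  have hotimes : ∀ a b : X, otimes a b ⊆
      {x | familyLattice.of S a ⊓ familyLattice.of S b ≤ familyLattice.of S x} := by
    rintro a b x hx p ⟨hpa, hpb⟩ hpx
    exact ((hprime p p.2).mem_or_mem a b ⟨x, hx, hpx⟩).elim hpa hpb
  -- The inclusions `hoplus` and `hotimes`, inherited from the points of `S`, make the pullback of
  -- any prime ideal of the lattice prime in `X`.
  have hmem : ∀ q ∈ latticeSpec (familyLattice S), familyLattice.of S ⁻¹' q ∈ S := by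
    intro q hq
    have hpr : IsMultiPrimeIdeal oplus otimes (familyLattice.of S ⁻¹' q) := by
      refine ⟨fun a b ha hb x hx => ?_, ?_⟩
      · exact latticeSpec.le_iff.mp (hoplus a b hx) ⟨q, hq⟩
          ((latticeSpec.sup_mem_iff ⟨q, hq⟩ _ _).mpr ⟨ha, hb⟩)
      · rintro a b ⟨x, hx, hxq⟩
        exact (latticeSpec.inf_mem_iff ⟨q, hq⟩ _ _).mp
          (latticeSpec.le_iff.mp (hotimes a b hx) ⟨q, hq⟩ hxq)
    obtain rfl | rfl := hS
    -- Every point of `S` contains `ξ₀` and omits `ξ₁`, so these map to `⊥` and `⊤`, and pullbacks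
    -- are proper.
    · have h₀ : familyLattice.of (properPrimeIdeals oplus otimes ξ₀ ξ₁) ξ₀ = ⊥ :=
        Subtype.ext (eq_empty_of_forall_notMem fun p hp => hp p.2.2.1)
      have h₁ : familyLattice.of (properPrimeIdeals oplus otimes ξ₀ ξ₁) ξ₁ = ⊤ :=
        Subtype.ext (eq_univ_of_forall fun p => p.2.2.2)
      refine ⟨hpr, ?_, ?_⟩
      · rw [mem_preimage, h₀]
        exact latticeSpec.bot_mem ⟨q, hq⟩
      · rw [mem_preimage, h₁]
        exact latticeSpec.top_notMem ⟨q, hq⟩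
    · exact hpr
  refine ⟨familyLattice S, inferInstance, inferInstance, familyLattice.of S,
    familyLattice.generatesLattice S,
    ⟨hmem, familyLattice.isSIsomorphism_specPreimage hmem hspec⟩, ?_, ?_, hoplus, hotimes⟩
  · intro L' _ _ θ hθ _
    refine ⟨familyLattice.lift hθ, familyLattice.lift_comp_of hθ, fun l hl => ?_⟩
    refine (familyLattice.generatesLattice S).eqOn ?_
    rintro _ ⟨x, rfl⟩
    exact congrFun (hl.trans (familyLattice.lift_comp_of hθ).symm) x
  · intro L₁ _ _ φ₁ hφ₁ hiso
    have hsurj : Function.Surjective (specPreimage S φ₁ hφ₁) := by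
      obtain ⟨-, g, -, -, hfg⟩ := hiso
      exact hfg.surjective
    let e : familyLattice S ≃o L₁ :=
      RelIso.ofSurjective
        (OrderEmbedding.ofMapLEIff (familyLattice.lift hφ₁)
          fun _ _ => familyLattice.lift_le_lift_iff hφ₁ hsurj)
        (familyLattice.lift_surjective hφ₁ hiso)
    have he : e ∘ familyLattice.of S = φ₁ := familyLattice.lift_comp_of hφ₁
    refine ⟨e, he, fun l hl => ?_⟩
    refine (familyLattice.generatesLattice S).eqOn ?_
    rintro _ ⟨x, rfl⟩
    exact congrFun (hl.trans he.symm) x
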